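/- Let $\mathbf{GLP}$ be the polymodal provability logic in the propositional language with modalities $[0],[1],[2],\dots$ (and any set of propositional variables), where $\langle n\rangle\varphi$ abbreviates $\neg[n]\neg\varphi$. Its axioms are the classical propositional tautologies and all instances of $[n](\varphi\to\psi)\to([n]\varphi\to[n]\psi)$, of $[n]([n]\varphi\to\varphi)\to[n]\varphi$, of $\langle m\rangle\varphi\to[n]\langle m\rangle\varphi$ for $m<n$, and of $[m]\varphi\to[n]\varphi$ for $m\le n$; its rules are modus ponens and necessitation $\varphi\,/\,[n]\varphi$ for every $n$. For a formula $\varphi$ put $Q_1(\varphi):=\varphi$ and $Q_{k+1}(\varphi):=\varphi\lor[0]Q_k(\varphi)$ for $k\ge 1$. A substitution is a map from formulas to formulas that preserves the connectives and the modalities; it is determined by its values on the variables. A substitution $\sigma$ is a unifier of $\varphi$ (in $\mathbf{GLP}$) if $\mathbf{GLP}\vdash\sigma(\varphi)$. For substitutions $\sigma,\tau$ write $\tau\le\sigma$ if there is a substitution $\theta$ such that $\mathbf{GLP}\vdash\tau(q)\leftrightarrow\theta(\sigma(q))$ for all variables $q$. For a variable $p$, a formula $\psi$ is identified with the substitution that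 sends $p$ to $\psi$ and leaves every other variable unchanged. Then: (1) For every formula $\varphi$: $\mathbf{GLP}\vdash[1]\varphi$ if and only if $\mathbf{GLP}\vdash Q_k(\varphi)$ for some $k\ge 1$. (2) For every variable $p$ and every substitution $\sigma$: $\sigma$ is a unifier of $[1]p$ in $\mathbf{GLP}$ if and only if $\sigma\le(Q_k(p)\to p)$ for some $k\ge 1$. -/

import Mathlib

/-- Formulas of polymodal propositional logic with modalities `[0], [1], [2], …` and propositional
variables from `α`. Falsum, implication and the boxes are primitive. -/
inductive Fm (α : Type*) : Type _
  | var : α → Fm α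
  | bot : Fm α
  | imp : Fm α → Fm α → Fm α
  | box : ℕ → Fm α → Fm α

namespace Fm

variable {α : Type*}

/-- Negation. -/
def neg (φ : Fm α) : Fm α := imp φ bot

/-- Disjunction. -/
def or (φ ψ : Fm α) : Fm α := imp (neg φ) ψ

/-- Conjunction. -/
def and (φ ψ : Fm α) : Fm α := neg (imp φ (neg ψ))

/-- Equivalence. -/
def iff (φ ψ : Fm α) : Fm α := and (imp φ ψ) (imp ψ φ)

/-- The dual modality `⟨n⟩φ`, that is, `¬[n]¬φ`. -/
def dia (n : ℕ) (φ : Fm α) : Fm α := neg (box n (neg φ))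

/-- Truth-table evaluation, with variables and boxed formulas treated as propositional atoms
whose truth values are given by `v`. -/
def boolEval (v : Fm α → Prop) : Fm α → Prop
  | var p => v (var p)
  | bot => False
  | imp φ ψ => boolEval v φ → boolEval v ψ
  | box n φ => v (box n φ)

/-- `φ` is (a modal instance of) a tautology of classical propositional calculus. -/
def IsTautology (φ : Fm α) : Prop := ∀ v : Fm α → Prop, boolEval v φ

/-- The action of the substitution `σ` on formulas: the unique extension of `σ` that preserves the
connectives and the modalities. -/
def subst (σ : α → Fm α) : Fm α → Fm α
  | var p => σ p
  | bot => bot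
  | imp φ ψ => imp (subst σ φ) (subst σ ψ)
  | box n φ => box n (subst σ φ)

/-- The formulas `Q_k(φ)`, for `k ≥ 1`: `Q_1(φ) = φ` and `Q_{k+1}(φ) = φ ∨ [0] Q_k(φ)`.
The value at `k = 0` is a dummy. -/
def Q : ℕ → Fm α → Fm α
  | 0, φ => φ
  | 1, φ => φ
  | k + 2, φ => or φ (box 0 (Q (k + 1) φ))

end Fm

/-- Derivability in the polymodal provability logic `GLP`. -/
inductive GLP {α : Type*} : Fm α → Prop
  | taut (φ : Fm α) : φ.IsTautology → GLP φ
  | distr (n : ℕ) (φ ψ : Fm α) :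
      GLP (((φ.imp ψ).box n).imp ((φ.box n).imp (ψ.box n)))
  | loeb (n : ℕ) (φ : Fm α) : GLP ((((φ.box n).imp φ).box n).imp (φ.box n))
  | diaBox (m n : ℕ) (φ : Fm α) : m < n → GLP ((φ.dia m).imp ((φ.dia m).box n))
  | monotone (m n : ℕ) (φ : Fm α) : m ≤ n → GLP ((φ.box m).imp (φ.box n))
  | mp (φ ψ : Fm α) : GLP (φ.imp ψ) → GLP φ → GLP ψ
  | nec (n : ℕ) (φ : Fm α) : GLP φ → GLP (φ.box n)

/-- The substitution `σ` is a unifier of `φ` in `GLP`. -/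
def IsUnifier {α : Type*} (σ : α → Fm α) (φ : Fm α) : Prop := GLP (φ.subst σ)

/-- `τ ≤ σ` in `GLP`, that is, `σ` is more general than `τ`: for some substitution `θ`,
`GLP` proves `τ(q) ↔ θ(σ(q))` for all variables `q`. -/
def LessGeneral {α : Type*} (τ σ : α → Fm α) : Prop :=
  ∃ θ : α → Fm α, ∀ q : α, GLP ((τ q).iff ((σ q).subst θ))

/-- The substitution `p ↦ ψ`, which leaves all variables other than `p` unchanged. -/
def singleSubst {α : Type*} [DecidableEq α] (p : α) (ψ : Fm α) : α → Fm α :=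
  Function.update Fm.var p ψ

open Fm

namespace GLP

variable {α : Type*}

/-! From `Q_k(φ)` to `[1]φ`: reason by cases on `[0]Q_k(φ)`. If it holds, monotonicity reduces to
the previous `k`; if not, its negation is boxed by `[1]`, and under `[1]` the disjunction
`Q_{k+1}(φ)` collapses to `φ`. Conversely, if no `Q_k(φ)` is provable, Zorn gives a maximal
`[0]`-closed theory `D` omitting them all. All theorems are true at a point where `[0]` means
membership in `D` and `[1]` membership in `DiaClosure D`, so it suffices that `φ` is not in
`DiaClosure D`. By maximality, every element of that closure lies in `D` up to a disjunct
`[0]Q_k(φ)`; for `φ` itself this would put `Q_{k+1}(φ)` in `D`. -/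

theorem of_taut₁ {φ ψ : Fm α} (h : (φ.imp ψ).IsTautology) (h₁ : GLP φ) : GLP ψ :=
  mp _ _ (taut _ h) h₁

theorem of_taut₂ {φ ψ χ : Fm α} (h : (φ.imp (ψ.imp χ)).IsTautology) (h₁ : GLP φ) (h₂ : GLP ψ) :
    GLP χ :=
  mp _ _ (of_taut₁ h h₁) h₂

theorem trans {φ ψ χ : Fm α} (h₁ : GLP (φ.imp ψ)) (h₂ : GLP (ψ.imp χ)) : GLP (φ.imp χ) :=
  of_taut₂ (by intro v; simp only [boolEval]; tauto) h₁ h₂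

/-- Boxes are monotone with respect to provable implication. -/
theorem box_mono (n : ℕ) {φ ψ : Fm α} (h : GLP (φ.imp ψ)) : GLP ((φ.box n).imp (ψ.box n)) :=
  mp _ _ (distr n φ ψ) (nec n _ h)

theorem box_mono₂ (n : ℕ) {φ ψ χ : Fm α} (h : GLP (φ.imp (ψ.imp χ))) :
    GLP ((φ.box n).imp ((ψ.box n).imp (χ.box n))) :=
  trans (box_mono n h) (distr n ψ χ)

/-- Transitivity of each modality. -/
theorem box_box (n : ℕ) (φ : Fm α) : GLP ((φ.box n).imp ((φ.box n).box n)) := by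
  -- Löb's axiom is applied to `φ ∧ [n]φ`.
  have h₁ : GLP (((φ.and (φ.box n)).box n).imp (φ.box n)) :=
    box_mono n (taut _ (by intro v; simp only [boolEval, Fm.and, Fm.neg]; tauto))
  have h₂ : GLP (φ.imp (((φ.and (φ.box n)).box n).imp (φ.and (φ.box n)))) :=
    of_taut₁ (by intro v; simp only [boolEval, Fm.and, Fm.neg]; tauto) h₁
  have h₃ : GLP (((φ.and (φ.box n)).box n).imp ((φ.box n).box n)) :=
    box_mono n (taut _ (by intro v; simp only [boolEval, Fm.and, Fm.neg]; tauto))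
  exact trans (box_mono n h₂) (trans (loeb n _) h₃)

/-- Negated boxes persist along larger modalities. -/
theorem neg_box_imp_box (m n : ℕ) (h : m < n) (φ : Fm α) :
    GLP ((φ.box m).neg.imp ((φ.box m).neg.box n)) := by
  have h₁ : GLP ((φ.neg.neg.box m).imp (φ.box m)) :=
    box_mono m (taut _ (by intro v; simp only [boolEval, Fm.neg]; tauto))
  have h₂ : GLP ((φ.box m).imp (φ.neg.neg.box m)) :=
    box_mono m (taut _ (by intro v; simp only [boolEval, Fm.neg]; tauto))
  have h₃ : GLP ((φ.box m).neg.imp (φ.neg.dia m)) :=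
    of_taut₁ (by intro v; simp only [boolEval, Fm.neg, Fm.dia]; tauto) h₁
  have h₄ : GLP ((φ.neg.dia m).imp (φ.box m).neg) :=
    of_taut₁ (by intro v; simp only [boolEval, Fm.neg, Fm.dia]; tauto) h₂
  exact trans h₃ (trans (diaBox m n _ h) (box_mono n h₄))

/-- `[1]Q_k(φ)` implies `[1]φ`. -/
theorem box_one_Q_imp (φ : Fm α) : ∀ k : ℕ, GLP (((Q k φ).box 1).imp (φ.box 1))
  | 0 => taut _ fun _ h => h
  | 1 => taut _ fun _ h => h
  | k + 2 => by
    have h₁ : GLP (((Q (k + 1) φ).box 0).imp (φ.box 1)) :=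
      trans (monotone 0 1 _ zero_le_one) (box_one_Q_imp φ (k + 1))
    have h₂ : GLP (((Q (k + 2) φ).box 1).imp
        ((((Q (k + 1) φ).box 0).neg.box 1).imp (φ.box 1))) :=
      box_mono₂ 1 (taut _ (by intro v; simp only [boolEval, Q, Fm.or, Fm.neg]; tauto))
    have h₃ := of_taut₂ (χ := (((Q (k + 1) φ).box 0).neg.imp
        (((Q (k + 2) φ).box 1).imp (φ.box 1))))
      (by intro v; simp only [boolEval, Fm.neg]; tauto) h₂
      (neg_box_imp_box 0 1 zero_lt_one (Q (k + 1) φ))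
    exact of_taut₂ (by intro v; simp only [boolEval, Fm.neg]; tauto) h₁ h₃

/-- `[1](Q_k(φ) → φ)` is provable. -/
theorem box_one_Q_imp_self (φ : Fm α) : ∀ k : ℕ, GLP (((Q k φ).imp φ).box 1)
  | 0 => nec _ _ (taut _ fun _ h => h)
  | 1 => nec _ _ (taut _ fun _ h => h)
  | k + 2 => by
    have h₁ : GLP (((Q (k + 1) φ).box 0).imp (φ.box 1)) :=
      trans (monotone 0 1 _ zero_le_one) (box_one_Q_imp φ (k + 1))
    have h₂ : GLP ((φ.box 1).imp (((Q (k + 2) φ).imp φ).box 1)) :=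
      box_mono 1 (taut _ (by intro v; simp only [boolEval]; tauto))
    have h₃ : GLP ((((Q (k + 1) φ).box 0).neg.box 1).imp (((Q (k + 2) φ).imp φ).box 1)) :=
      box_mono 1 (taut _ (by intro v; simp only [boolEval, Q, Fm.or, Fm.neg]; tauto))
    exact of_taut₂ (by intro v; simp only [boolEval, Fm.neg]; tauto) (trans h₁ h₂)
      (trans (neg_box_imp_box 0 1 zero_lt_one (Q (k + 1) φ)) h₃)

theorem Q_imp_Q_succ (φ : Fm α) : ∀ k : ℕ, GLP ((Q k φ).imp (Q (k + 1) φ))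
  | 0 => taut _ fun _ h => h
  | 1 => taut _ (by intro v; simp only [boolEval, Q, Fm.or, Fm.neg]; tauto)
  | k + 2 => of_taut₁ (by intro v; simp only [boolEval, Q, Fm.or, Fm.neg]; tauto)
      (box_mono 0 (Q_imp_Q_succ φ (k + 1)))

theorem Q_imp_Q (φ : Fm α) {k l : ℕ} (h : k ≤ l) : GLP ((Q k φ).imp (Q l φ)) := by
  induction l, h using Nat.le_induction with
  | base => exact taut _ fun _ h => h
  | succ l _ ih => exact trans ih (Q_imp_Q_succ φ l)

theorem subst {φ : Fm α} (θ : α → Fm α) (h : GLP φ) : GLP (φ.subst θ) := by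
  induction h with
  | taut φ h =>
    refine taut _ fun v => ?_
    have key : ∀ ψ : Fm α, boolEval (fun χ => boolEval v (χ.subst θ)) ψ ↔
        boolEval v (ψ.subst θ) := by
      intro ψ
      induction ψ with
      | imp a b iha ihb => exact imp_congr iha ihb
      | _ => exact Iff.rfl
    exact (key φ).1 (h _)
  | distr n φ ψ => exact distr n _ _
  | loeb n φ => exact loeb n _
  | diaBox m n φ h => exact diaBox m n _ h
  | monotone m n φ h => exact monotone m n _ h
  | mp φ ψ _ _ ih₁ ih₂ => exact mp _ _ ih₁ ih₂
  | nec n φ _ ih => exact nec n _ ih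

end GLP

theorem Fm.subst_Q {α : Type*} (θ : α → Fm α) (φ : Fm α) :
    ∀ k : ℕ, (Q k φ).subst θ = Q k (φ.subst θ)
  | 0 => rfl
  | 1 => rfl
  | k + 2 => by simp only [Q, Fm.or, Fm.neg, Fm.subst, subst_Q θ φ (k + 1)]

/-- Sets of formulas that contain `GLP` and are closed under modus ponens and necessitation
for `[0]`. -/
structure IsZeroTheory {α : Type*} (D : Set (Fm α)) : Prop where
  glp : ∀ {φ}, GLP φ → φ ∈ D
  mp : ∀ {φ ψ}, φ.imp ψ ∈ D → φ ∈ D → ψ ∈ D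
  nec : ∀ {φ}, φ ∈ D → φ.box 0 ∈ D

/-- The closure under modus ponens of `D` together with all `⟨0⟩χ` such that `¬χ` is not in `D`. -/
inductive DiaClosure {α : Type*} (D : Set (Fm α)) : Fm α → Prop
  | base {φ : Fm α} : φ ∈ D → DiaClosure D φ
  | dia {χ : Fm α} : χ.neg ∉ D → DiaClosure D (χ.dia 0)
  | mp {φ ψ : Fm α} : DiaClosure D (φ.imp ψ) → DiaClosure D φ → DiaClosure D ψ

/-- The truth valuation at a point whose `[0]`-theory is `D`, whose `[1]`-theory is
`DiaClosure D`, and at which all higher boxes hold. -/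
def pointVal {α : Type*} (D : Set (Fm α)) : Fm α → Prop
  | .box 0 φ => φ ∈ D
  | .box 1 φ => DiaClosure D φ
  | _ => True

namespace IsZeroTheory

variable {α : Type*} {D : Set (Fm α)}

theorem of_taut₂ (hD : IsZeroTheory D) {φ ψ χ : Fm α} (h : (φ.imp (ψ.imp χ)).IsTautology)
    (h₁ : φ ∈ D) (h₂ : ψ ∈ D) : χ ∈ D :=
  hD.mp (hD.mp (hD.glp (GLP.taut _ h)) h₁) h₂

theorem box_one_mem (hD : IsZeroTheory D) {φ : Fm α} (h : φ ∈ D) : φ.box 1 ∈ D :=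
  hD.mp (hD.glp (GLP.monotone 0 1 _ zero_le_one)) (hD.nec h)

/-- The added generators `⟨0⟩χ` satisfy `⟨0⟩χ → [1]⟨0⟩χ`. This closure is what validates Löb's axiom
for `[1]` at the point. -/
theorem diaClosure_box_one (hD : IsZeroTheory D) {φ : Fm α} (h : DiaClosure D φ) :
    DiaClosure D (φ.box 1) := by
  induction h with
  | base h => exact .base (hD.box_one_mem h)
  | dia h => exact .mp (.base (hD.glp (GLP.diaBox 0 1 _ zero_lt_one))) (.dia h)
  | mp _ _ ih₁ ih₂ => exact .mp (.mp (.base (hD.glp (GLP.distr 1 _ _))) ih₁) ih₂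

/-- Theorems of `GLP` hold under the valuation `pointVal D`. -/
theorem boolEval_pointVal (hD : IsZeroTheory D) {φ : Fm α} (h : GLP φ) :
    boolEval (pointVal D) φ := by
  induction h with
  | taut φ h => exact h _
  | distr n φ ψ =>
    match n with
    | 0 => exact fun h₁ h₂ => hD.mp h₁ h₂
    | 1 => exact fun h₁ h₂ => .mp h₁ h₂
    | n + 2 => exact fun _ _ => trivial
  | loeb n φ =>
    match n with
    | 0 => exact fun h₁ => hD.mp h₁ (hD.mp (hD.glp (GLP.loeb 0 _)) (hD.nec h₁))
    | 1 =>
      exact fun h₁ => .mp h₁ (.mp (.base (hD.glp (GLP.loeb 1 _))) (hD.diaClosure_box_one h₁))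
    | n + 2 => exact fun _ => trivial
  | diaBox m n φ h =>
    match n with
    | 1 =>
      obtain rfl : m = 0 := by omega
      exact fun h₁ => DiaClosure.dia h₁
    | n + 2 => exact fun _ => trivial
  | monotone m n φ h =>
    match n with
    | 0 =>
      obtain rfl : m = 0 := by omega
      exact id
    | 1 =>
      obtain rfl | rfl : m = 0 ∨ m = 1 := by omega
      · exact fun h₁ => DiaClosure.base h₁
      · exact id
    | n + 2 => exact fun _ => trivial
  | mp φ ψ _ _ ih₁ ih₂ => exact ih₁ ih₂
  | nec n φ h _ =>
    match n with
    | 0 => exact hD.glp h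
    | 1 => exact DiaClosure.base (hD.glp h)
    | n + 2 => trivial

/-- The extension of a theory by a formula `χ` and `[0]χ`. -/
theorem extend (hD : IsZeroTheory D) (χ : Fm α) :
    IsZeroTheory {ψ | χ.imp ((χ.box 0).imp ψ) ∈ D} where
  glp h := hD.glp (GLP.of_taut₁ (by intro v; simp only [boolEval]; tauto) h)
  mp h₁ h₂ := hD.of_taut₂ (by intro v; simp only [boolEval]; tauto) h₁ h₂
  nec {ψ} h := by
    have h₁ : ((χ.box 0).imp (((χ.box 0).box 0).imp (ψ.box 0))) ∈ D :=
      hD.mp (hD.glp (GLP.trans (GLP.distr 0 _ _)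
        (GLP.of_taut₁ (by intro v; simp only [boolEval]; tauto)
          (GLP.distr 0 (χ.box 0) ψ)))) (hD.nec h)
    exact hD.of_taut₂ (by intro v; simp only [boolEval]; tauto) h₁ (hD.glp (GLP.box_box 0 χ))

end IsZeroTheory

/-- A theory containing no `Q_k(φ)` extends to a maximal such theory. -/
theorem exists_maximal_zeroTheory {α : Type*} {φ : Fm α}
    (h : ∀ k, 1 ≤ k → ¬ GLP (Q k φ)) :
    ∃ D : Set (Fm α), Maximal (fun D => IsZeroTheory D ∧ ∀ k, 1 ≤ k → Q k φ ∉ D) D := by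
  have h₀ : IsZeroTheory {ψ : Fm α | GLP ψ} := ⟨id, GLP.mp _ _, GLP.nec 0 _⟩
  obtain ⟨D, -, hD⟩ := zorn_subset_nonempty
    {D : Set (Fm α) | IsZeroTheory D ∧ ∀ k, 1 ≤ k → Q k φ ∉ D} (by
      intro c hc hchain ⟨E, hE⟩
      refine ⟨⋃₀ c, ⟨⟨fun hψ => ⟨E, hE, (hc hE).1.glp hψ⟩, ?_, ?_⟩, ?_⟩,
        fun s hs => Set.subset_sUnion_of_mem hs⟩
      · rintro ψ χ ⟨A, hA, h₁⟩ ⟨B, hB, h₂⟩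
        rcases hchain.total hA hB with hAB | hBA
        · exact ⟨B, hB, (hc hB).1.mp (hAB h₁) h₂⟩
        · exact ⟨A, hA, (hc hA).1.mp h₁ (hBA h₂)⟩
      · rintro ψ ⟨A, hA, h₁⟩
        exact ⟨A, hA, (hc hA).1.nec h₁⟩
      · rintro k hk ⟨A, hA, h₁⟩
        exact (hc hA).2 k hk h₁) {ψ | GLP ψ} ⟨h₀, h⟩
  exact ⟨D, hD⟩

/-- The only use of maximality: it bounds what the added `⟨0⟩χ` can prove beyond `D`. -/
theorem DiaClosure.exists_or_box_Q_mem {α : Type*} {φ : Fm α} {D : Set (Fm α)}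
    (hD : Maximal (fun D => IsZeroTheory D ∧ ∀ k, 1 ≤ k → Q k φ ∉ D) D)
    {ψ : Fm α} (h : DiaClosure D ψ) : ∃ k, 1 ≤ k ∧ ψ.or ((Q k φ).box 0) ∈ D := by
  have hT := hD.prop.1
  induction h with
  | base h =>
    exact ⟨1, le_rfl, hT.mp (hT.glp (GLP.taut _
      (by intro v; simp only [boolEval, Fm.or, Fm.neg]; tauto))) h⟩
  | @dia χ h =>
    by_contra! hk
    -- If no `k` works, adjoining `¬χ` and `[0]¬χ` still omits every `Q_k(φ)`, so maximality forces
    -- `¬χ` into `D`.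
    refine h (hD.le_of_ge ⟨hT.extend χ.neg, fun k hk₁ hQ => hk k hk₁ ?_⟩ ?_ ?_)
    -- Boxing `¬χ → [0]¬χ → Q_k(φ)` and using transitivity yields `[0]¬χ → [0]Q_k(φ)`.
    · have h₁ : ((χ.neg.box 0).imp (((χ.neg.box 0).box 0).imp ((Q k φ).box 0))) ∈ D :=
        hT.of_taut₂ (by intro v; simp only [boolEval]; tauto)
          (hT.mp (hT.glp (GLP.distr 0 _ _)) (hT.nec hQ))
          (hT.glp (GLP.distr 0 (χ.neg.box 0) (Q k φ)))
      exact hT.of_taut₂ (by intro v; simp only [boolEval, Fm.or, Fm.neg, Fm.dia]; tauto) h₁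
        (hT.glp (GLP.box_box 0 χ.neg))
    · intro ψ hψ
      exact hT.mp (hT.glp (GLP.taut _ (by intro v; simp only [boolEval]; tauto))) hψ
    · exact hT.glp (GLP.taut _ (by intro v; simp only [boolEval]; tauto))
  | @mp χ ψ _ _ ih₁ ih₂ =>
    obtain ⟨k, hk, h₁⟩ := ih₁
    obtain ⟨l, -, h₂⟩ := ih₂
    have e₁ := hT.glp (GLP.box_mono 0 (GLP.Q_imp_Q φ (le_max_left k l)))
    have e₂ := hT.glp (GLP.box_mono 0 (GLP.Q_imp_Q φ (le_max_right k l)))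
    have f₁ : (χ.imp ψ).or ((Q (max k l) φ).box 0) ∈ D :=
      hT.of_taut₂ (by intro v; simp only [boolEval, Fm.or, Fm.neg]; tauto) h₁ e₁
    have f₂ : χ.or ((Q (max k l) φ).box 0) ∈ D :=
      hT.of_taut₂ (by intro v; simp only [boolEval, Fm.or, Fm.neg]; tauto) h₂ e₂
    exact ⟨max k l, hk.trans (le_max_left k l),
      hT.of_taut₂ (by intro v; simp only [boolEval, Fm.or, Fm.neg]; tauto) f₁ f₂⟩

theorem GLP.exists_Q_of_box_one {α : Type*} {φ : Fm α} (h : GLP (φ.box 1)) :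
    ∃ k, 1 ≤ k ∧ GLP (Q k φ) := by
  by_contra! hQ
  obtain ⟨D, hD⟩ := exists_maximal_zeroTheory hQ
  obtain ⟨k, hk, hmem⟩ := DiaClosure.exists_or_box_Q_mem hD (hD.prop.1.boolEval_pointVal h)
  obtain ⟨k, rfl⟩ := Nat.exists_eq_add_of_le' hk
  -- After the shift of `k`, `hmem` is `Q (k + 2) φ ∈ D` by definition.
  exact hD.prop.2 (k + 2) (by omega) hmem

theorem mainTheorem10 {α : Type*} [DecidableEq α] :
    (∀ φ : Fm α, GLP (φ.box 1) ↔ ∃ k : ℕ, 1 ≤ k ∧ GLP (Fm.Q k φ)) ∧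
    (∀ (p : α) (σ : α → Fm α),
      IsUnifier σ ((Fm.var p).box 1) ↔
        ∃ k : ℕ, 1 ≤ k ∧
          LessGeneral σ (singleSubst p ((Fm.Q k (Fm.var p)).imp (Fm.var p)))) := by
  refine ⟨fun φ => ⟨GLP.exists_Q_of_box_one, ?_⟩, fun p σ => ⟨fun h => ?_, ?_⟩⟩
  · rintro ⟨k, -, hk⟩
    exact GLP.mp _ _ (GLP.box_one_Q_imp φ k) (GLP.nec 1 _ hk)
  · obtain ⟨k, hk, hQ⟩ := GLP.exists_Q_of_box_one h
    -- `σ` itself is the witness: `Q_k(σ p)` is provable, so `Q_k(σ p) → σ p` is equivalent to `σ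
    -- p`.
    refine ⟨k, hk, σ, fun q => ?_⟩
    by_cases hq : q = p
    · subst hq
      simp only [singleSubst, Function.update_self, Fm.subst, Fm.subst_Q]
      exact GLP.of_taut₁ (by intro v; simp only [boolEval, Fm.iff, Fm.and, Fm.neg]; tauto) hQ
    · simp only [singleSubst, Function.update_of_ne hq, Fm.subst]
      exact GLP.taut _ (by intro v; simp only [boolEval, Fm.iff, Fm.and, Fm.neg]; tauto)
  · rintro ⟨k, -, θ, hθ⟩
    have h₁ := hθ p
    simp only [singleSubst, Function.update_self] at h₁
    exact GLP.mp _ _ (GLP.box_mono 1 (GLP.of_taut₁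
      (by intro v; simp only [boolEval, Fm.iff, Fm.and, Fm.neg]; tauto) h₁))
      (GLP.subst θ (GLP.box_one_Q_imp_self (Fm.var p) k))
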